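/- Let $n_k\to\infty$ be a sequence of sample sizes and $p_k$ a sequence of dimensions with $\sqrt{n_k}=o(p_k)$ and $p_k=o(n_k^{2/3})$ as $k\to\infty$. For each $k$ let $\Sigma^*=\Sigma^*_k$ be a diagonal positive definite $p_k\times p_k$ matrix, and put $\Omega^*=\Sigma^{*-1}$. Let $X_1,\dots,X_{n_k}$ be i.i.d. $N(0,\Sigma^*)$ and $\hat\Sigma=\frac1{n_k}\sum_{i=1}^{n_k}X_iX_i^T$. Write $\lambda_1(A)\ge\lambda_2(A)\ge\dots\ge\lambda_p(A)$ for the eigenvalues, with multiplicity, of a symmetric $p\times p$ matrix $A$, and $\|A\|$ for its spectral norm. Assume that $\max(\|\Sigma^*\|,\|\Omega^*\|)=O(1)$ and that the top eigengap $\lambda_1(\Sigma^*)-\lambda_2(\Sigma^*)$ is of constant order (bounded above, and bounded below by a positive constant, for all large $k$). Then (dropping the index $k$): 1. $\lambda_1(\hat\Sigma)$ is not $\sqrt n$-consistent, that is, $\sqrt n\,(\lambda_1(\hat\Sigma)-\lambda_1(\Sigma^*))$ is not $O_P(1)$. 2. For all large $k$, almost surely $\hat\Sigma$ is invertible and $\lambda_p(\hat\Sigma^{-1})=\lambda_1(\hat\Sigma)^{-1}$;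 and $\lambda_p(\hat\Sigma^{-1})$ is not $\sqrt n$-consistent, that is, $\sqrt n\,(\lambda_p(\hat\Sigma^{-1})-\lambda_p(\Omega^*))$ is not $O_P(1)$. 3. In particular, in this regime (in which $p^2/n\to\infty$) asymptotic normality fails for both: neither $\dfrac{\sqrt n\,(\lambda_1(\hat\Sigma)-\lambda_1(\Sigma^*))}{\sqrt2\,\lambda_1(\Sigma^*)}$ nor $\dfrac{\sqrt n\,(\lambda_p(\hat\Sigma^{-1})-\lambda_p(\Omega^*))}{\sqrt2\,\lambda_p(\Omega^*)}$ converges in distribution to $N(0,1)$. -/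

import Mathlib

open MeasureTheory ProbabilityTheory Filter Asymptotics
open scoped Topology Matrix.Norms.L2Operator

namespace EigenCounter

open Classical in
/-- `eig A m` is the `m`-th largest eigenvalue `λ_m(A)`, `m = 1, …, p` (counted with multiplicity),
of a real symmetric `p × p` matrix `A`. It is set to `0` outside this range of `m` and
for matrices that are not symmetric. -/
noncomputable def eig {p : ℕ} (A : Matrix (Fin p) (Fin p) ℝ) (m : ℕ) : ℝ :=
  if h : A.IsHermitian ∧ 1 ≤ m ∧ m ≤ p then
    h.1.eigenvalues₀ ⟨m - 1, by rw [Fintype.card_fin]; omega⟩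
  else 0

/-- The law of an i.i.d. sample `X₁, …, X_n` from `N(0, S)` on `ℝ^p`. -/
noncomputable def sampleLaw {p : ℕ} (n : ℕ) (S : Matrix (Fin p) (Fin p) ℝ) :
    Measure (Fin n → EuclideanSpace ℝ (Fin p)) :=
  Measure.pi fun _ => multivariateGaussian 0 S

/-- The sample covariance matrix `n⁻¹ ∑ i, X_i X_iᵀ`. -/
noncomputable def sampleCov {n p : ℕ} (X : Fin n → EuclideanSpace ℝ (Fin p)) :
    Matrix (Fin p) (Fin p) ℝ :=
  (n : ℝ)⁻¹ • ∑ i, Matrix.vecMulVec (X i) (X i)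

/-- `Y_k = O_P(1)`, the law of `Y_k` being taken under the probability measure `P k`. -/
def BoundedInProbability {Ω : ℕ → Type*} [∀ k, MeasurableSpace (Ω k)]
    (P : ∀ k, Measure (Ω k)) (Y : ∀ k, Ω k → ℝ) : Prop :=
  ∀ ε : ℝ, 0 < ε → ∃ M : ℝ, ∀ᶠ k in atTop, (P k).real {ω | M < |Y k ω|} ≤ ε

/-- The estimators `T k` of `θ k` are root-`n`-consistent, `√n (T - θ) = O_P(1)`. -/
def RootNConsistent {Ω : ℕ → Type*} [∀ k, MeasurableSpace (Ω k)]
    (P : ∀ k, Measure (Ω k)) (n : ℕ → ℕ) (T : ∀ k, Ω k → ℝ) (θ : ℕ → ℝ) : Prop :=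
  BoundedInProbability P fun k ω => Real.sqrt (n k) * (T k ω - θ k)

/-- `Y_k` converges in distribution to `N(0, 1)` (convergence of the distribution functions). -/
def AsympStdNormal {Ω : ℕ → Type*} [∀ k, MeasurableSpace (Ω k)]
    (P : ∀ k, Measure (Ω k)) (Y : ∀ k, Ω k → ℝ) : Prop :=
  ∀ t : ℝ, Tendsto (fun k => (P k).real {ω | Y k ω ≤ t}) atTop
    (𝓝 ((gaussianReal 0 1).real (Set.Iic t)))

end EigenCounter

/-! The top sample eigenvalue is biased upwards by at least a constant times `p/n`, and `√n · p/n =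
p/√n → ∞`. To see the bias, let `j` carry the top diagonal entry of `Σ*` and let `u` be the `j`-th
column of the `n × p` data matrix. Testing the companion matrix `n⁻¹XXᵀ` on `u`
(`le_eig_one_sampleCov`) gives `λ₁(Σ̂) ≥ ‖u‖²/n + n⁻¹ ∑_{l ≠ j} (u·X_l)²/‖u‖²`, where `X_l` is the
`l`-th column.

The first term is `λ₁(Σ*) + O_P(n^{-1/2})` by Chebyshev. As `Σ*` is diagonal, the other columns are
independent of `u`, so each score `u·X_l/‖u‖` is `N(0, Σ*_ll)` given `u` and is rarely small.
Markov's inequality for the number of small scores shows that more than half are bounded below with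
high probability, so the second term is at least of order `p/n`. Independence among the columns `l`
is not needed. This is `exists_event_le_eig_one_sampleCov`.

Hence the rescaled error exceeds every level with probability at least `3/4` (`ExceedsLevels`),
which contradicts both tightness and a normal limit. The inverse follows from `λ_p(A⁻¹) = λ₁(A)⁻¹`,
with divergence to `-∞`; the upper growth rate enters through `p ≤ n`, which makes `Σ̂` almost
surely invertible. -/

namespace EigenCounter

/-! ### Extreme eigenvalues and the sample covariance matrix -/

section LinearAlgebra

variable {p : ℕ} {A : Matrix (Fin p) (Fin p) ℝ}

theorem eig_of_isHermitian (hA : A.IsHermitian) {m : ℕ} (h1 : 1 ≤ m) (hm : m ≤ p) :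
    eig A m = hA.eigenvalues₀ ⟨m - 1, by rw [Fintype.card_fin]; omega⟩ := by
  rw [eig, dif_pos ⟨hA, h1, hm⟩]

theorem spectrum_eq_range_eigenvalues₀ (hA : A.IsHermitian) :
    spectrum ℝ A = Set.range hA.eigenvalues₀ := by
  rw [hA.spectrum_real_eq_range_eigenvalues]
  exact (Fintype.equivOfCardEq (Fintype.card_fin _)).symm.surjective.range_comp hA.eigenvalues₀

theorem isGreatest_eig_one (hA : A.IsHermitian) (hp : 1 ≤ p) :
    IsGreatest (spectrum ℝ A) (eig A 1) := by
  rw [spectrum_eq_range_eigenvalues₀ hA, eig_of_isHermitian hA le_rfl hp]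
  refine ⟨⟨_, rfl⟩, ?_⟩
  rintro _ ⟨i, rfl⟩
  exact hA.eigenvalues₀_antitone (Fin.le_def.2 (Nat.zero_le _))

theorem isLeast_eig_last (hA : A.IsHermitian) (hp : 1 ≤ p) :
    IsLeast (spectrum ℝ A) (eig A p) := by
  rw [spectrum_eq_range_eigenvalues₀ hA, eig_of_isHermitian hA hp le_rfl]
  refine ⟨⟨_, rfl⟩, ?_⟩
  rintro _ ⟨i, rfl⟩
  refine hA.eigenvalues₀_antitone (Fin.le_def.2 ?_)
  have h : (i : ℕ) < p := i.2.trans_eq (Fintype.card_fin p)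
  exact Nat.le_sub_one_of_lt h

/-- Inversion maps the spectrum of `A` onto that of `A⁻¹` and reverses the order on positive reals.
-/
theorem eig_inv_last (hA : A.PosDef) (hp : 1 ≤ p) : eig A⁻¹ p = (eig A 1)⁻¹ := by
  have hinv := hA.inv
  have hG := isGreatest_eig_one hA.isHermitian hp
  have hL := isLeast_eig_last hinv.isHermitian hp
  have hu : IsUnit A := hA.isUnit
  have hpos : ∀ B : Matrix (Fin p) (Fin p) ℝ, B.PosDef → ∀ x ∈ spectrum ℝ B, 0 < x := by
    intro B hB x hx
    rw [hB.isHermitian.spectrum_real_eq_range_eigenvalues] at hx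
    obtain ⟨i, rfl⟩ := hx
    exact hB.eigenvalues_pos i
  have hspec : ∀ x : ℝ, x ∈ spectrum ℝ A⁻¹ ↔ x⁻¹ ∈ spectrum ℝ A := by
    intro x
    obtain ⟨a, rfl⟩ := hu
    rw [← Matrix.coe_units_inv, ← spectrum.map_inv, Set.mem_inv]
  refine le_antisymm (hL.2 ?_) ?_
  · rw [hspec, inv_inv]
    exact hG.1
  · have h1 := hG.2 ((hspec _).1 hL.1)
    exact inv_le_of_inv_le₀ (hpos _ hinv _ hL.1) h1

theorem dotProduct_mulVec_le_eig_one (hA : A.IsHermitian) (hp : 1 ≤ p) (v : Fin p → ℝ) :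
    v ⬝ᵥ A.mulVec v ≤ eig A 1 * (v ⬝ᵥ v) := by
  open scoped MatrixOrder in
  have h : A ≤ algebraMap ℝ _ (eig A 1) :=
    le_algebraMap_of_spectrum_le (isGreatest_eig_one hA hp).2 hA.isSelfAdjoint
  have h2 := (Matrix.le_iff.1 h).dotProduct_mulVec_nonneg v
  simp only [Matrix.sub_mulVec, dotProduct_sub, star_trivial, Algebra.algebraMap_eq_smul_one,
    Matrix.smul_mulVec, Matrix.one_mulVec, dotProduct_smul, smul_eq_mul] at h2
  linarith

variable {n : ℕ}

theorem sampleCov_apply (X : Fin n → EuclideanSpace ℝ (Fin p)) (j l : Fin p) :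
    sampleCov X j l = (n : ℝ)⁻¹ * ∑ i, X i j * X i l := by
  simp [sampleCov, Matrix.sum_apply, Matrix.vecMulVec_apply]

theorem isHermitian_sampleCov (X : Fin n → EuclideanSpace ℝ (Fin p)) :
    (sampleCov X).IsHermitian := by
  ext j l
  simp [sampleCov_apply, mul_comm]

theorem dotProduct_sampleCov_mulVec (X : Fin n → EuclideanSpace ℝ (Fin p)) (v : Fin p → ℝ) :
    v ⬝ᵥ (sampleCov X).mulVec v = (n : ℝ)⁻¹ * ∑ i, (∑ j, X i j * v j) ^ 2 := by
  simp only [dotProduct, Matrix.mulVec, sampleCov_apply, Finset.mul_sum, Finset.sum_mul, sq]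
  rw [Finset.sum_comm_cycle]
  refine Finset.sum_congr rfl fun i _ => ?_
  rw [Finset.sum_comm]
  refine Finset.sum_congr rfl fun j _ => Finset.sum_congr rfl fun l _ => ?_
  ring

/-- The variational lower bound for the top eigenvalue of the sample covariance `n⁻¹ XᵀX` through
its companion `n⁻¹ XXᵀ`. -/
theorem le_eig_one_sampleCov (hp : 1 ≤ p) (X : Fin n → EuclideanSpace ℝ (Fin p))
    (u : Fin n → ℝ) (hu : 0 < ∑ i, u i ^ 2) :
    (∑ j, (∑ i, u i * X i j) ^ 2) / (n * ∑ i, u i ^ 2) ≤ eig (sampleCov X) 1 := by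
  set v : Fin p → ℝ := fun j => ∑ i, u i * X i j with hv
  set w : Fin n → ℝ := fun i => ∑ j, X i j * v j with hw
  set U := ∑ i, u i ^ 2
  have hn : 0 < (n : ℝ) := by
    rcases Nat.eq_zero_or_pos n with rfl | h
    · simp [U] at hu
    · exact_mod_cast h
  have hvv : v ⬝ᵥ v = ∑ j, v j ^ 2 := by simp [dotProduct, sq]
  have hcomm : ∑ j, v j ^ 2 = ∑ i, u i * w i := by
    simp only [hw, hv, sq, Finset.mul_sum, Finset.sum_mul]
    rw [Finset.sum_comm]
    refine Finset.sum_congr rfl fun i _ => ?_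
    refine Finset.sum_congr rfl fun j _ => Finset.sum_congr rfl fun l _ => ?_
    ring
  -- With `v = Xᵀu` and `w = Xv`, `‖v‖² = u·w`; Cauchy–Schwarz turns this into a lower bound for the
  -- Rayleigh quotient of `Σ̂` at `v`.
  have hcs : (∑ j, v j ^ 2) ^ 2 ≤ U * ∑ i, w i ^ 2 := by
    rw [hcomm]
    exact Finset.sum_mul_sq_le_sq_mul_sq _ _ _
  have hR := dotProduct_mulVec_le_eig_one (isHermitian_sampleCov X) hp v
  rw [dotProduct_sampleCov_mulVec, hvv] at hR
  set V := ∑ j, v j ^ 2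
  have hV0 : 0 ≤ V := by positivity
  rcases hV0.eq_or_lt with hV | hV
  -- If `v = 0` the quotient carries no information, but the claimed bound is `0` and `Σ̂` is
  -- positive semidefinite.
  · rw [← hV, zero_div]
    have hpos : (sampleCov X).PosSemidef := by
      refine Matrix.PosSemidef.of_dotProduct_mulVec_nonneg (isHermitian_sampleCov X) fun x => ?_
      rw [star_trivial, dotProduct_sampleCov_mulVec]
      positivity
    have := (isGreatest_eig_one hpos.isHermitian hp).1
    rw [hpos.isHermitian.spectrum_real_eq_range_eigenvalues] at this
    obtain ⟨i, hi⟩ := this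
    rw [← hi]
    exact hpos.eigenvalues_nonneg i
  · rw [div_le_iff₀ (by positivity)]
    refine le_of_mul_le_mul_right ?_ hV
    calc V * V = V ^ 2 := by ring
      _ ≤ U * ∑ i, w i ^ 2 := hcs
      _ = n * U * ((n : ℝ)⁻¹ * ∑ i, w i ^ 2) := by field_simp
      _ ≤ n * U * (eig (sampleCov X) 1 * V) := by gcongr
      _ = _ := by ring

/-- A vector on which the quadratic form vanishes is orthogonal to every observation, hence to their
span. -/
theorem posDef_sampleCov (X : Fin n → EuclideanSpace ℝ (Fin p))
    (hX : ⊤ ≤ Submodule.span ℝ (Set.range X)) (hn : 1 ≤ n) : (sampleCov X).PosDef := by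
  refine Matrix.PosDef.of_dotProduct_mulVec_pos (isHermitian_sampleCov X) fun v hv => ?_
  rw [star_trivial, dotProduct_sampleCov_mulVec]
  have hn' : (0 : ℝ) < n := by exact_mod_cast hn
  refine mul_pos (inv_pos.2 hn') (lt_of_le_of_ne (by positivity) fun h0 => hv ?_)
  rw [eq_comm, Finset.sum_eq_zero_iff_of_nonneg fun _ _ => sq_nonneg _] at h0
  have horth : ∀ y : EuclideanSpace ℝ (Fin p), inner ℝ y (WithLp.toLp 2 v) = 0 := by
    intro y
    have hy : y ∈ Submodule.span ℝ (Set.range X) := hX trivial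
    induction hy using Submodule.span_induction with
    | mem y hy =>
      obtain ⟨i, rfl⟩ := hy
      have := h0 i (Finset.mem_univ i)
      rw [sq_eq_zero_iff] at this
      rw [← this]
      simp [PiLp.inner_apply, mul_comm]
    | zero => simp
    | add x y _ _ hx hy => rw [inner_add_left, hx, hy, add_zero]
    | smul a x _ hx => rw [inner_smul_left, hx, mul_zero]
  have := inner_self_eq_zero.1 (horth (WithLp.toLp 2 v))
  ext j
  simpa using congrArg (fun z : EuclideanSpace ℝ (Fin p) => z j) this

theorem exists_eig_one_eq_diag (hA : A.IsDiag) (hp : 1 ≤ p) :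
    ∃ i, eig A 1 = A i i := by
  have hd : Matrix.diagonal A.diag = A := hA.diagonal_diag
  have hH : A.IsHermitian := by
    rw [← hd]
    exact Matrix.isHermitian_diagonal _
  have := (isGreatest_eig_one hH hp).1
  rw [← hd, spectrum_diagonal] at this
  obtain ⟨i, hi⟩ := this
  exact ⟨i, by rw [← hd, ← hi]; simp⟩

theorem diag_le_norm (hA : A.IsDiag) (hA' : A.PosDef) (i : Fin p) :
    A i i ≤ ‖A‖ ∧ (A i i)⁻¹ ≤ ‖A⁻¹‖ := by
  have hd : Matrix.diagonal A.diag = A := hA.diagonal_diag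
  have hinv : A⁻¹ = Matrix.diagonal fun j => (A j j)⁻¹ := by
    refine Matrix.inv_eq_right_inv ?_
    nth_rewrite 1 [← hd]
    rw [Matrix.diagonal_mul_diagonal, ← Matrix.diagonal_one]
    congr 1
    ext j
    exact mul_inv_cancel₀ hA'.diag_pos.ne'
  constructor
  · rw [← hd, Matrix.l2_opNorm_diagonal, hd]
    exact (le_abs_self _).trans (norm_le_pi_norm A.diag i)
  · rw [hinv, Matrix.l2_opNorm_diagonal]
    exact (le_abs_self _).trans (norm_le_pi_norm (fun j => (A j j)⁻¹) i)

end LinearAlgebra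

end EigenCounter

namespace EigenCounter

/-! ### Almost sure full rank of a Gaussian sample -/

section FullRank

variable {p : ℕ} {S : Matrix (Fin p) (Fin p) ℝ}

/-- A proper subspace lies in a hyperplane `y^⊥` with `y ≠ 0`, and `⟨y, x⟩` is a real Gaussian of
variance `yᵀSy > 0`, which has no atoms. -/
theorem multivariateGaussian_submodule_eq_zero (hS : S.PosDef)
    {V : Submodule ℝ (EuclideanSpace ℝ (Fin p))} (hV : V ≠ ⊤) :
    multivariateGaussian 0 S (V : Set (EuclideanSpace ℝ (Fin p))) = 0 := by
  have hperp : Vᗮ ≠ ⊥ := fun h => hV ((Submodule.orthogonal_eq_bot_iff).1 h)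
  obtain ⟨y, hyV, hy⟩ := Submodule.exists_mem_ne_zero_of_ne_bot hperp
  set L : StrongDual ℝ (EuclideanSpace ℝ (Fin p)) := innerSL ℝ y with hL
  have hvar : Var[L; multivariateGaussian 0 S] = y ⬝ᵥ S.mulVec y := by
    rw [← covarianceBilin_multivariateGaussian (μ := 0) hS.posSemidef y y,
      covarianceBilin_self IsGaussian.memLp_two_id]
    rfl
  have hpos : 0 < Var[L; multivariateGaussian 0 S] := by
    rw [hvar]
    have hy' : (y : Fin p → ℝ) ≠ 0 := fun h => hy (by ext j; simpa using congrFun h j)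
    simpa using hS.dotProduct_mulVec_pos hy'
  have hmap := IsGaussian.map_eq_gaussianReal (μ := multivariateGaussian 0 S) L
  have hna := nullSingletonClass_gaussianReal (μ := (multivariateGaussian 0 S)[L])
    (v := Var[L; multivariateGaussian 0 S].toNNReal) (by simpa using hpos)
  refine measure_mono_null (t := L ⁻¹' {0}) (fun x hx => ?_) ?_
  · simp only [Set.mem_preimage, Set.mem_singleton_iff, hL, innerSL_apply_apply]
    exact (Submodule.mem_orthogonal' V y).1 hyV x hx
  · rw [← Measure.map_apply L.continuous.measurable (measurableSet_singleton 0), hmap]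
    exact measure_singleton 0

/-- Induction on the sample size: fewer than `dim E` vectors span a proper subspace, which the next
independent draw almost surely avoids. The order of integration is swapped so that the earlier draws
are fixed first. -/
theorem ae_linearIndependent_pi {E : Type*} [NormedAddCommGroup E] [NormedSpace ℝ E]
    [FiniteDimensional ℝ E] [MeasurableSpace E] [BorelSpace E] (μ : Measure E)
    [IsProbabilityMeasure μ] (hμ : ∀ V : Submodule ℝ E, V ≠ ⊤ → μ V = 0) (n : ℕ)
    (hn : n ≤ Module.finrank ℝ E) :
    ∀ᵐ X ∂(Measure.pi fun _ : Fin n => μ), LinearIndependent ℝ X := by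
  have : SecondCountableTopology E :=
    (Module.finBasis ℝ E).equivFun.toContinuousLinearEquiv.toHomeomorph.secondCountableTopology
  induction n with
  | zero => exact Eventually.of_forall fun X => linearIndependent_empty_type
  | succ m ih =>
    have hmp := measurePreserving_piFinSuccAbove (fun _ : Fin (m + 1) => μ) 0
    rw [← hmp.symm.map_eq, ae_map_iff (by fun_prop)
      isOpen_setOfPred_linearIndependent.measurableSet]
    have hmeas : MeasurableSet {z : E × (Fin m → E) |
        LinearIndependent ℝ ((MeasurableEquiv.piFinSuccAbove (fun _ => E) 0).symm z)} :=
      (MeasurableEquiv.piFinSuccAbove (fun _ => E) 0).symm.measurable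
        isOpen_setOfPred_linearIndependent.measurableSet
    refine (Measure.ae_prod_iff_ae_ae hmeas).2 ((Measure.ae_ae_comm hmeas).2 ?_)
    filter_upwards [ih (by omega)] with v hv
    have hne : Submodule.span ℝ (Set.range v) ≠ ⊤ := fun h => by
      have := finrank_range_le_card (R := ℝ) v
      rw [Set.finrank, h, finrank_top, Fintype.card_fin] at this
      omega
    have h0 := hμ _ hne
    rw [measure_eq_zero_iff_ae_notMem] at h0
    filter_upwards [h0] with x hx
    have hcons : (MeasurableEquiv.piFinSuccAbove (fun _ : Fin (m + 1) => E) 0).symm (x, v) =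
        Fin.cons x v := by
      simp only [MeasurableEquiv.piFinSuccAbove, Fin.insertNthEquiv_zero]
      rfl
    rw [hcons]
    exact hv.finCons hx

theorem ae_span_eq_top_pi {E : Type*} [NormedAddCommGroup E] [NormedSpace ℝ E]
    [FiniteDimensional ℝ E] [MeasurableSpace E] [BorelSpace E] (μ : Measure E)
    [IsProbabilityMeasure μ] (hμ : ∀ V : Submodule ℝ E, V ≠ ⊤ → μ V = 0) (n : ℕ)
    (hn : Module.finrank ℝ E ≤ n) :
    ∀ᵐ X ∂(Measure.pi fun _ : Fin n => μ), Submodule.span ℝ (Set.range X) = ⊤ := by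
  induction n, hn using Nat.le_induction with
  | base =>
    filter_upwards [ae_linearIndependent_pi μ hμ _ le_rfl] with X hX
    exact hX.span_eq_top_of_card_eq_finrank' (Fintype.card_fin _)
  | succ m _ ih =>
    have hmp := measurePreserving_piFinSuccAbove (fun _ : Fin (m + 1) => μ) 0
    have hsnd := (measurePreserving_snd (μ := μ) (ν := Measure.pi fun _ : Fin m => μ)).comp hmp
    filter_upwards [hsnd.quasiMeasurePreserving.ae ih] with X hX
    rw [eq_top_iff, ← hX]
    refine Submodule.span_mono ?_
    rintro _ ⟨i, rfl⟩
    exact ⟨_, rfl⟩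

theorem ae_span_eq_top (hS : S.PosDef) {n : ℕ} (hn : p ≤ n) :
    ∀ᵐ X ∂(sampleLaw n S), Submodule.span ℝ (Set.range X) = ⊤ := by
  exact ae_span_eq_top_pi (multivariateGaussian 0 S)
    (fun V hV => multivariateGaussian_submodule_eq_zero hS hV) n (by simpa using hn)

end FullRank

/-! ### Small-ball estimates for Gaussian linear forms -/

section SmallBall

/-- The density is at most `1/√v` (dropping the factor `√(2π)`), and the interval has length `2r`.
-/
theorem gaussianReal_abs_lt_le {v : NNReal} (hv : v ≠ 0) {r : ℝ} (hr : 0 ≤ r) :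
    (gaussianReal 0 v).real {x | |x| < r} ≤ 2 * r / √v := by
  have hv' : 0 < (v : ℝ) := NNReal.coe_pos.2 (pos_iff_ne_zero.2 hv)
  have hset : {x : ℝ | |x| < r} = Set.Ioo (-r) r := by
    ext x
    simp [abs_lt]
  have hpdf : ∀ x, gaussianPDFReal 0 v x ≤ (√v)⁻¹ := fun x => by
    rw [gaussianPDFReal]
    have h1 : Real.exp (-(x - 0) ^ 2 / (2 * v)) ≤ 1 :=
      Real.exp_le_one_iff.2 (div_nonpos_of_nonpos_of_nonneg
        (neg_nonpos.2 (sq_nonneg _)) (by positivity))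
    have h2 : √(v : ℝ) ≤ √(2 * Real.pi * v) := by
      refine Real.sqrt_le_sqrt ?_
      nlinarith [Real.pi_gt_three]
    calc _ ≤ (√(2 * Real.pi * v))⁻¹ * 1 := by gcongr
      _ ≤ (√v)⁻¹ := by
        rw [mul_one]
        exact inv_anti₀ (Real.sqrt_pos.2 hv') h2
  have hint : ∫ x in Set.Ioo (-r) r, gaussianPDFReal 0 v x ≤
      ∫ _ in Set.Ioo (-r) r, (√(v : ℝ))⁻¹ :=
    setIntegral_mono (integrable_gaussianPDFReal _ _).integrableOn (by simp) hpdf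
  rw [setIntegral_const, measureReal_def, Real.volume_Ioo, smul_eq_mul,
    ENNReal.toReal_ofReal (by linarith)] at hint
  rw [hset, measureReal_def, gaussianReal_apply_eq_integral _ hv, ENNReal.toReal_ofReal
    (setIntegral_nonneg measurableSet_Ioo fun x _ => gaussianPDFReal_nonneg _ _ x)]
  refine hint.trans (le_of_eq ?_)
  rw [div_eq_mul_inv]
  ring

theorem map_sum_mul_pi_gaussianReal {ι : Type*} [Fintype ι] (v : NNReal) (u : ι → ℝ) :
    (Measure.pi fun _ : ι => gaussianReal 0 v).map (fun y => ∑ i, u i * y i) =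
      gaussianReal 0 (v * ∑ i, u i ^ 2).toNNReal := by
  have hmem : ∀ i, MemLp (fun x => u i * x) 2 (gaussianReal 0 v) := fun i =>
    (memLp_id_gaussianReal 2).const_mul (u i)
  have heval : ∀ i, HasGaussianLaw (fun y : ι → ℝ => u i * y i)
      (Measure.pi fun _ : ι => gaussianReal 0 v) := fun i => by
    refine ⟨?_⟩
    have h := (measurePreserving_eval (fun _ : ι => gaussianReal 0 v) i).map_eq
    have hc : (Measure.pi fun _ : ι => gaussianReal 0 v).map (fun y => u i * y i) =
        ((Measure.pi fun _ : ι => gaussianReal 0 v).map (Function.eval i)).map (u i * ·) :=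
      (Measure.map_map (by fun_prop) (by fun_prop)).symm
    rw [hc, h, gaussianReal_map_const_mul]
    infer_instance
  have hind : iIndepFun (fun i (y : ι → ℝ) => u i * y i)
      (Measure.pi fun _ : ι => gaussianReal 0 v) :=
    iIndepFun_pi (X := fun i x => u i * x) fun i => by fun_prop
  rw [(hind.hasGaussianLaw_fun_sum heval).map_eq_gaussianReal]
  congr 2
  · rw [integral_finsetSum _ fun i _ => (heval i).integrable]
    refine Finset.sum_eq_zero fun i _ => ?_
    rw [integral_const_mul, integral_eval]
    simp
  · have h := variance_sum_pi hmem
    rw [show (fun y : ι → ℝ => ∑ i, u i * y i) = ∑ i, fun y : ι → ℝ => u i * y i by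
      ext y; simp, h, Finset.mul_sum]
    refine Finset.sum_congr rfl fun i _ => ?_
    rw [variance_const_mul, variance_fun_id_gaussianReal, mul_comm]

/-- The score of an independent Gaussian vector along `u` is rarely small compared with `‖u‖`. -/
theorem pi_gaussianReal_small_ball {ι : Type*} [Fintype ι] {v : NNReal} (hv : v ≠ 0) (u : ι → ℝ)
    {δ : ℝ} (hδ : 0 < δ) :
    (Measure.pi fun _ : ι => gaussianReal 0 v).real
      {y | (∑ i, u i * y i) ^ 2 < δ ^ 2 * ∑ i, u i ^ 2} ≤ 2 * δ / √v := by
  have hv' : 0 < (v : ℝ) := NNReal.coe_pos.2 (pos_iff_ne_zero.2 hv)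
  have hU0 : 0 ≤ ∑ i, u i ^ 2 := by positivity
  rcases hU0.eq_or_lt with hU | hU
  -- For `u = 0` the strict inequality reads `0 < 0`, so the event is empty.
  · have : {y : ι → ℝ | (∑ i, u i * y i) ^ 2 < δ ^ 2 * ∑ i, u i ^ 2} = ∅ := by
      ext y
      simp only [← hU, mul_zero, Set.mem_ofPred_eq, Set.mem_empty_iff_false, iff_false, not_lt]
      positivity
    rw [this, measureReal_empty]
    positivity
  · set r := δ * √(∑ i, u i ^ 2)
    have hr : r ^ 2 = δ ^ 2 * ∑ i, u i ^ 2 := by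
      rw [mul_pow, Real.sq_sqrt hU0]
    have hset : {y : ι → ℝ | (∑ i, u i * y i) ^ 2 < δ ^ 2 * ∑ i, u i ^ 2} =
        (fun y => ∑ i, u i * y i) ⁻¹' {x | |x| < r} := by
      ext y
      simp only [Set.mem_ofPred_eq, Set.mem_preimage]
      rw [← hr, sq_lt_sq, abs_of_nonneg (show 0 ≤ r by positivity)]
    rw [hset, ← map_measureReal_apply (by fun_prop)
      (measurableSet_lt (by fun_prop) measurable_const), map_sum_mul_pi_gaussianReal]
    refine (gaussianReal_abs_lt_le (by simpa using mul_pos hv' hU) (by positivity)).trans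
      (le_of_eq ?_)
    rw [Real.coe_toNNReal _ (by positivity), Real.sqrt_mul hv'.le]
    have : √(∑ i, u i ^ 2) ≠ 0 := (Real.sqrt_pos.2 hU).ne'
    simp only [r]
    field_simp

end SmallBall

/-! ### Columns of the data matrix: independence and concentration -/

section Columns

variable {p : ℕ} {S : Matrix (Fin p) (Fin p) ℝ} {n : ℕ}

instance : IsProbabilityMeasure (sampleLaw n S) := by
  unfold sampleLaw
  infer_instance

/-- Jointly Gaussian coordinates with zero covariance are independent. -/
theorem map_pair_multivariateGaussian (hS : S.PosSemidef) {j l : Fin p} (hjl : S j l = 0) :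
    (multivariateGaussian 0 S).map (fun x => (x j, x l)) =
      (gaussianReal 0 (S j j).toNNReal).prod (gaussianReal 0 (S l l).toNNReal) := by
  have hlaw : HasGaussianLaw (fun x : EuclideanSpace ℝ (Fin p) => (x j, x l))
      (multivariateGaussian 0 S) :=
    HasGaussianLaw.map_of_measurable ((EuclideanSpace.proj j).prod (EuclideanSpace.proj l))
      IsGaussian.hasGaussianLaw_id (by fun_prop)
  have hind := hlaw.indepFun_of_covariance_eq_zero
    ((covariance_eval_multivariateGaussian hS j l).trans hjl)
  rw [(indepFun_iff_map_prod_eq_prod_map_map (by fun_prop) (by fun_prop)).1 hind,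
    (measurePreserving_eval_multivariateGaussian hS).map_eq,
    (measurePreserving_eval_multivariateGaussian hS).map_eq]
  rfl

theorem map_columns_sampleLaw (hS : S.PosSemidef) {j l : Fin p} (hjl : S j l = 0) :
    (sampleLaw n S).map (fun X => ((fun i => X i j), fun i => X i l)) =
      (Measure.pi fun _ : Fin n => gaussianReal 0 (S j j).toNNReal).prod
        (Measure.pi fun _ : Fin n => gaussianReal 0 (S l l).toNNReal) := by
  rw [← (measurePreserving_arrowProdEquivProdArrow ℝ ℝ (Fin n)
    (fun _ => gaussianReal 0 (S j j).toNNReal) fun _ => gaussianReal 0 (S l l).toNNReal).map_eq]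
  simp only [← map_pair_multivariateGaussian hS hjl]
  rw [← Measure.pi_map_pi (fun _ => by fun_prop), Measure.map_map (by fun_prop) (by fun_prop)]
  rfl

/-- Fubini: with column `j` frozen at `u`, column `l` is still an i.i.d. Gaussian vector, and the
small-ball bound is uniform in `u`. -/
theorem sampleLaw_small_cross_le (hS : S.PosDef) {j l : Fin p} (hjl : S j l = 0)
    {δ : ℝ} (hδ : 0 < δ) :
    (sampleLaw n S).real {X | (∑ i, X i j * X i l) ^ 2 < δ ^ 2 * ∑ i, X i j ^ 2} ≤
      2 * δ / √(S l l) := by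
  have hl : 0 < S l l := hS.diag_pos
  set T : Set ((Fin n → ℝ) × (Fin n → ℝ)) :=
    {z | (∑ i, z.1 i * z.2 i) ^ 2 < δ ^ 2 * ∑ i, z.1 i ^ 2} with hT
  have hTm : MeasurableSet T := measurableSet_lt (by fun_prop) (by fun_prop)
  have hpre : {X : Fin n → EuclideanSpace ℝ (Fin p) |
      (∑ i, X i j * X i l) ^ 2 < δ ^ 2 * ∑ i, X i j ^ 2} =
      (fun X => ((fun i => X i j), fun i => X i l)) ⁻¹' T := rfl
  rw [hpre, ← map_measureReal_apply (by fun_prop) hTm, map_columns_sampleLaw hS.posSemidef hjl]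
  refine ENNReal.toReal_le_of_le_ofReal (by positivity) ?_
  rw [Measure.prod_apply hTm]
  refine (lintegral_mono (g := fun _ => ENNReal.ofReal (2 * δ / √(S l l))) fun u => ?_).trans
    (by simp)
  have := pi_gaussianReal_small_ball (v := (S l l).toNNReal) (by simpa using hl) u hδ
  rw [Real.coe_toNNReal _ hl.le] at this
  exact (ENNReal.le_ofReal_iff_toReal_le (measure_ne_top _ _) (by positivity)).2 this

/-- Scaling isolates one universal constant for the Chebyshev bound; its value is never needed. -/
theorem variance_sq_gaussianReal (v : NNReal) :
    Var[fun x => x ^ 2; gaussianReal 0 v] = v ^ 2 * Var[fun x => x ^ 2; gaussianReal 0 1] := by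
  have h : gaussianReal 0 v = (gaussianReal 0 1).map (√(v : ℝ) * ·) := by
    rw [gaussianReal_map_const_mul]
    congr 1
    · simp
    · ext
      simp
  rw [h, variance_map (by fun_prop) (by fun_prop), ← variance_const_mul]
  congr 1
  ext x
  simp [mul_pow]

theorem sampleLaw_diag_deviation_le (hS : S.PosSemidef) (hn : 1 ≤ n) (j : Fin p) {K : ℝ}
    (hK : 0 < K) :
    (sampleLaw n S).real {X | K / √n ≤ |(∑ i, X i j ^ 2) / n - S j j|} ≤
      S j j ^ 2 * Var[fun x => x ^ 2; gaussianReal 0 1] / K ^ 2 := by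
  have hn' : (0 : ℝ) < n := by exact_mod_cast hn
  have hmp := measurePreserving_eval_multivariateGaussian (μ := 0) hS (i := j)
  rw [PiLp.zero_apply] at hmp
  have hmem : MemLp (fun x : EuclideanSpace ℝ (Fin p) => x j ^ 2) 2 (multivariateGaussian 0 S) := by
    have h4 : MemLp (fun x : ℝ => x ^ 2) 2 (gaussianReal 0 (S j j).toNNReal) := by
      have := (memLp_id_gaussianReal (μ := 0) (v := (S j j).toNNReal) 4).norm_rpow_div 2
      refine (this.congr_norm (by fun_prop) (Eventually.of_forall fun x => ?_)).mono_exponent ?_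
      · simp
      · rw [ENNReal.le_div_iff_mul_le] <;> norm_num
    exact h4.comp_measurePreserving hmp
  have hvar : Var[fun x : EuclideanSpace ℝ (Fin p) => x j ^ 2; multivariateGaussian 0 S] =
      S j j ^ 2 * Var[fun x => x ^ 2; gaussianReal 0 1] := by
    have h := variance_sq_gaussianReal (S j j).toNNReal
    rw [Real.coe_toNNReal _ hS.diag_nonneg, ← hmp.map_eq,
      variance_map (by fun_prop) (by fun_prop)] at h
    exact h
  have hmean : ∫ x, x j ^ 2 ∂(multivariateGaussian 0 S) = S j j := by
    rw [← variance_eval_multivariateGaussian (μ := 0) hS j, variance_of_integral_eq_zero]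
    · fun_prop
    · have := integral_map (μ := multivariateGaussian 0 S) (φ := fun x => x j)
        (by fun_prop) (f := fun x : ℝ => x) (by fun_prop)
      rw [← this, hmp.map_eq, integral_id_gaussianReal]
  set Y : (Fin n → EuclideanSpace ℝ (Fin p)) → ℝ := ∑ i, fun X => X i j ^ 2 with hY
  have hYapp : ∀ X, Y X = ∑ i, X i j ^ 2 := fun X => by simp [hY]
  have hYi : ∀ i : Fin n, MemLp (fun X : Fin n → EuclideanSpace ℝ (Fin p) => X i j ^ 2) 2
      (sampleLaw n S) := fun i =>
    hmem.comp_measurePreserving (measurePreserving_eval (fun _ => multivariateGaussian 0 S) i)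
  have hYmem : MemLp Y 2 (sampleLaw n S) := memLp_finsetSum' _ fun i _ => hYi i
  have hYvar : Var[Y; sampleLaw n S] = n * (S j j ^ 2 * Var[fun x => x ^ 2; gaussianReal 0 1]) := by
    have := variance_sum_pi (ι := Fin n) (μ := fun _ => multivariateGaussian 0 S)
      (X := fun _ x => x j ^ 2) fun _ => hmem
    rw [sampleLaw, hY, this, hvar]
    simp
  have hYmean : (sampleLaw n S)[Y] = n * S j j := by
    have h1 : ∀ i : Fin n, ∫ X, X i j ^ 2 ∂(sampleLaw n S) = S j j := fun i => by
      rw [← hmean]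
      exact integral_comp_eval (μ := fun _ : Fin n => multivariateGaussian 0 S)
        (f := fun x : EuclideanSpace ℝ (Fin p) => x j ^ 2) (by fun_prop)
    simp only [hYapp]
    rw [integral_finsetSum _ fun i _ => (hYi i).integrable (by norm_num)]
    simp [h1]
  have hc : 0 < K * √n := by positivity
  have hcheb := meas_ge_le_variance_div_sq hYmem hc
  rw [hYvar, hYmean] at hcheb
  have hsq : √(n : ℝ) * √n = n := Real.mul_self_sqrt hn'.le
  have hset : {X : Fin n → EuclideanSpace ℝ (Fin p) |
      K / √n ≤ |(∑ i, X i j ^ 2) / n - S j j|} = {X | K * √n ≤ |Y X - n * S j j|} := by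
    ext X
    simp only [Set.mem_ofPred_eq, hYapp]
    have h1 : (∑ i, X i j ^ 2) / n - S j j = ((∑ i, X i j ^ 2) - n * S j j) / n := by
      field_simp
    have h2 : K / √n = K * √n / n := by
      rw [div_eq_div_iff (by positivity) hn'.ne', mul_assoc, hsq]
    rw [h1, h2, abs_div, abs_of_pos hn', div_le_div_iff_of_pos_right hn']
  rw [hset]
  refine (ENNReal.toReal_le_of_le_ofReal ?_ hcheb).trans (le_of_eq ?_)
  · have := variance_nonneg (fun x : ℝ => x ^ 2) (gaussianReal 0 1)
    positivity
  · rw [mul_pow, Real.sq_sqrt hn'.le]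
    field_simp

end Columns

end EigenCounter

namespace EigenCounter

/-! ### The event on which the top eigenvalue is inflated -/

section GoodEvent

/-- If each of the events `F l` has probability at most `η`, at least half of them occur with
probability at most `2 η`. -/
theorem measureReal_half_le_card {Ω ι : Type*} [MeasurableSpace Ω] {μ : Measure Ω}
    [IsProbabilityMeasure μ] [DecidableEq ι] (s : Finset ι) (hs : s.Nonempty) {F : ι → Set Ω}
    [∀ ω, DecidablePred fun l => ω ∈ F l]
    (hF : ∀ l ∈ s, MeasurableSet (F l)) {η : ℝ} (hη : ∀ l ∈ s, μ.real (F l) ≤ η) :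
    μ.real {ω | (s.card : ℝ) / 2 ≤ (s.filter fun l => ω ∈ F l).card} ≤ 2 * η := by
  have hcard : (0 : ℝ) < s.card := by exact_mod_cast hs.card_pos
  set f : Ω → ℝ := fun ω => ∑ l ∈ s, (F l).indicator 1 ω with hf
  have hfc : ∀ ω, f ω = (s.filter fun l => ω ∈ F l).card := fun ω => by
    simp [hf, Set.indicator_apply]
  have hint : ∀ l ∈ s, Integrable ((F l).indicator (1 : Ω → ℝ)) μ := fun l hl =>
    (integrable_const (1 : ℝ)).indicator (hF l hl)
  have hmk := mul_meas_ge_le_integral_of_nonneg (μ := μ) (f := f)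
    (Eventually.of_forall fun ω => by rw [hfc]; positivity)
    (integrable_finsetSum _ hint) ((s.card : ℝ) / 2)
  have hI : ∫ ω, f ω ∂μ ≤ s.card * η := by
    rw [integral_finsetSum _ hint, ← nsmul_eq_mul]
    refine Finset.sum_le_card_nsmul _ _ _ fun l hl => ?_
    rw [integral_indicator_one (hF l hl)]
    exact hη l hl
  simp only [hfc] at hmk hI
  have h2 := hmk.trans hI
  have h3 : (s.card : ℝ) / 2 * μ.real {ω | (s.card : ℝ) / 2 ≤ (s.filter fun l => ω ∈ F l).card} ≤
      (s.card : ℝ) / 2 * (2 * η) := by linarith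
  exact le_of_mul_le_mul_left h3 (by positivity)

variable {p n : ℕ} {S : Matrix (Fin p) (Fin p) ℝ}

open Classical in
-- Two bad events are removed: at least half of the scores being small, and `‖u‖²/n` deviating from
-- `S j j`. Small scores of probability `1/16` give `1/8` for the first by the half-count bound; the
-- second costs another `1/8`.
theorem exists_event_le_eig_one_sampleCov (hS : S.PosDef) (hdiag : S.IsDiag) (hp : 2 ≤ p)
    (hn : 1 ≤ n) (j : Fin p) {C δ K : ℝ} (hδ : 0 < δ) (hK : 0 < K)
    (hub : ∀ l, S l l ≤ C) (hlb : ∀ l, (S l l)⁻¹ ≤ C) (hδC : 2 * δ * √C ≤ 1 / 16)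
    (hKC : C ^ 2 * Var[fun x => x ^ 2; gaussianReal 0 1] / K ^ 2 ≤ 1 / 8)
    (hKn : K / √n < S j j) :
    ∃ G : Set (Fin n → EuclideanSpace ℝ (Fin p)), MeasurableSet G ∧
      3 / 4 ≤ (sampleLaw n S).real G ∧
      ∀ X ∈ G, S j j - K / √n + δ ^ 2 * (p - 1) / (2 * n) ≤ eig (sampleCov X) 1 := by
  have hn' : (0 : ℝ) < n := by exact_mod_cast hn
  have hpos : ∀ l, 0 < S l l := fun l => hS.diag_pos
  set s : Finset (Fin p) := Finset.univ.erase j with hs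
  have hcard : s.card = p - 1 := by simp [hs]
  have hcard' : (s.card : ℝ) = p - 1 := by
    rw [hcard, Nat.cast_sub (by omega), Nat.cast_one]
  set F : Fin p → Set (Fin n → EuclideanSpace ℝ (Fin p)) := fun l =>
    {X | (∑ i, X i j * X i l) ^ 2 < δ ^ 2 * ∑ i, X i j ^ 2} with hF
  have hFm : ∀ l, MeasurableSet (F l) := fun l => measurableSet_lt (by fun_prop) (by fun_prop)
  set B₁ : Set (Fin n → EuclideanSpace ℝ (Fin p)) :=
    {X | (s.card : ℝ) / 2 ≤ (s.filter fun l => X ∈ F l).card} with hB₁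
  set B₂ : Set (Fin n → EuclideanSpace ℝ (Fin p)) :=
    {X | K / √n ≤ |(∑ i, X i j ^ 2) / n - S j j|} with hB₂
  have hB₁m : MeasurableSet B₁ := by
    have hc : ∀ X, ((s.filter fun l => X ∈ F l).card : ℝ) = ∑ l ∈ s, (F l).indicator 1 X :=
      fun X => by simp [Set.indicator_apply]
    simp only [hB₁, hc]
    exact measurableSet_le measurable_const
      (Finset.measurable_sum _ fun l _ => measurable_one.indicator (hFm l))
  have hB₂m : MeasurableSet B₂ := measurableSet_le measurable_const (by fun_prop)
  have hP₁ : (sampleLaw n S).real B₁ ≤ 1 / 8 := by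
    have h := measureReal_half_le_card (μ := sampleLaw n S) s
      (Finset.card_pos.1 (by omega)) (fun l _ => hFm l) (η := 1 / 16) fun l hl => by
        have hjl : S j l = 0 := hdiag (Finset.ne_of_mem_erase hl).symm
        refine (sampleLaw_small_cross_le hS hjl hδ).trans (le_trans ?_ hδC)
        rw [div_eq_mul_inv, ← Real.sqrt_inv]
        have := Real.sqrt_le_sqrt (hlb l)
        gcongr
    exact h.trans (by norm_num)
  have hP₂ : (sampleLaw n S).real B₂ ≤ 1 / 8 := by
    refine (sampleLaw_diag_deviation_le hS.posSemidef hn j hK).trans (le_trans ?_ hKC)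
    have h1 := variance_nonneg (fun x : ℝ => x ^ 2) (gaussianReal 0 1)
    have h2 := hub j
    have h3 := (hpos j).le
    gcongr
  refine ⟨(B₁ ∪ B₂)ᶜ, (hB₁m.union hB₂m).compl, ?_, fun X hX => ?_⟩
  · rw [probReal_compl_eq_one_sub (hB₁m.union hB₂m)]
    have := measureReal_union_le (μ := sampleLaw n S) B₁ B₂
    linarith
  · simp only [Set.mem_compl_iff, Set.mem_union, not_or] at hX
    obtain ⟨h₁, h₂⟩ := hX
    simp only [hB₁, hB₂, Set.mem_ofPred_eq, not_le] at h₁ h₂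
    set U := ∑ i, X i j ^ 2 with hU
    have hdev := (abs_lt.1 h₂).1
    -- `hKn` keeps the deviation below `S j j`, so `u ≠ 0` and the variational bound applies.
    have hU0 : 0 < U := by
      have : 0 < U / n := by linarith
      exact (div_pos_iff_of_pos_right hn').1 this
    refine le_trans ?_ (le_eig_one_sampleCov (by omega) X (fun i => X i j) hU0)
    have hsplit : ∑ l, (∑ i, X i j * X i l) ^ 2 =
        U ^ 2 + ∑ l ∈ s, (∑ i, X i j * X i l) ^ 2 := by
      have hj : ∑ i, X i j * X i j = U := by simp only [hU, sq]
      rw [← Finset.add_sum_erase _ _ (Finset.mem_univ j), hj]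
    have hcompl := Finset.card_filter_add_card_filter_not (s := s) fun l => X ∈ F l
    have hcompl' : ((s.filter fun l => X ∈ F l).card : ℝ) + (s.filter fun l => X ∉ F l).card =
        s.card := by exact_mod_cast hcompl
    have hsum : (p - 1) / 2 * (δ ^ 2 * U) ≤ ∑ l ∈ s, (∑ i, X i j * X i l) ^ 2 := by
      calc ((p : ℝ) - 1) / 2 * (δ ^ 2 * U)
          ≤ (s.filter fun l => X ∉ F l).card * (δ ^ 2 * U) := by
            refine mul_le_mul_of_nonneg_right ?_ (by positivity)
            linarith
        _ ≤ ∑ l ∈ s.filter fun l => X ∉ F l, (∑ i, X i j * X i l) ^ 2 := by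
            rw [← nsmul_eq_mul]
            refine Finset.card_nsmul_le_sum _ _ _ fun l hl => ?_
            simpa [hF] using (Finset.mem_filter.1 hl).2
        _ ≤ _ := Finset.sum_le_sum_of_subset_of_nonneg (Finset.filter_subset _ _)
            fun _ _ _ => sq_nonneg _
    rw [hsplit]
    calc S j j - K / √n + δ ^ 2 * (p - 1) / (2 * n)
        ≤ U / n + δ ^ 2 * (p - 1) / (2 * n) := by linarith
      _ = (U ^ 2 + (p - 1) / 2 * (δ ^ 2 * U)) / (n * U) := by
          field_simp
      _ ≤ _ := by gcongr

end GoodEvent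

/-! ### Divergence with probability bounded below -/

section Divergence

variable {Ω : ℕ → Type*} [∀ k, MeasurableSpace (Ω k)] {P : ∀ k, Measure (Ω k)}
  {Y : ∀ k, Ω k → ℝ}

/-- Beyond every level, `Y k` exceeds it on an event of probability at least `3 / 4`. -/
def ExceedsLevels (P : ∀ k, Measure (Ω k)) (Y : ∀ k, Ω k → ℝ) : Prop :=
  ∀ M : ℝ, 0 ≤ M → ∀ᶠ k in atTop, ∃ G : Set (Ω k), MeasurableSet G ∧ 3 / 4 ≤ (P k).real G ∧
    ∀ᵐ ω ∂(P k), ω ∈ G → M ≤ Y k ω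

theorem ExceedsLevels.mono {Z : ∀ k, Ω k → ℝ} (h : ExceedsLevels P Y)
    (hYZ : ∀ M : ℝ, 0 ≤ M → ∃ M' : ℝ, 0 ≤ M' ∧
      ∀ᶠ k in atTop, ∀ᵐ ω ∂(P k), M' ≤ Y k ω → M ≤ Z k ω) :
    ExceedsLevels P Z := by
  intro M hM
  obtain ⟨M', hM', h'⟩ := hYZ M hM
  filter_upwards [h M' hM', h'] with k ⟨G, hG, hPG, hGY⟩ hk
  refine ⟨G, hG, hPG, ?_⟩
  filter_upwards [hGY, hk] with ω h1 h2 h3 using h2 (h1 h3)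

variable [∀ k, IsProbabilityMeasure (P k)]

theorem ExceedsLevels.not_boundedInProbability (h : ExceedsLevels P Y) :
    ¬ BoundedInProbability P Y := by
  intro hb
  obtain ⟨M, hM⟩ := hb (1 / 2) (by norm_num)
  obtain ⟨k, hk, G, -, hPG, hGY⟩ := (hM.and (h (|M| + 1) (by positivity))).exists
  have : (P k).real G ≤ (P k).real {ω | M < |Y k ω|} := by
    refine ENNReal.toReal_mono (measure_ne_top _ _) (measure_mono_ae ?_)
    filter_upwards [hGY] with ω h1 h2
    have h3 := h1 h2
    have h4 := le_abs_self (Y k ω)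
    have h5 := le_abs_self M
    show M < |Y k ω|
    linarith
  linarith

/-- Some `t` has normal distribution function above `1/2`, whereas `Y k ≤ t` eventually has
probability at most `1/4`. -/
theorem ExceedsLevels.not_asympStdNormal (h : ExceedsLevels P Y) :
    ¬ AsympStdNormal P Y := by
  intro hb
  have hcdf : Tendsto (fun t : ℝ => (gaussianReal 0 1).real (Set.Iic t)) atTop (𝓝 1) := by
    simpa [← cdf_eq_real] using tendsto_cdf_atTop (gaussianReal 0 1)
  obtain ⟨t, ht, ht0⟩ := ((hcdf.eventually_const_lt (show (1 / 2 : ℝ) < 1 by norm_num)).and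
    (eventually_ge_atTop 0)).exists
  obtain ⟨k, hk, G, hGm, hPG, hGY⟩ :=
    (((hb t).eventually_const_lt ht).and (h (t + 1) (by positivity))).exists
  have h1 : (P k).real {ω | Y k ω ≤ t} ≤ (P k).real Gᶜ := by
    refine ENNReal.toReal_mono (measure_ne_top _ _) (measure_mono_ae ?_)
    filter_upwards [hGY] with ω h1 (h2 : Y k ω ≤ t) h3
    have := h1 h3
    linarith
  rw [probReal_compl_eq_one_sub hGm] at h1
  linarith

theorem ExceedsLevels.not_asympStdNormal_of_neg (h : ExceedsLevels P fun k ω => -Y k ω) :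
    ¬ AsympStdNormal P Y := by
  intro hb
  have hcdf : Tendsto (fun t : ℝ => (gaussianReal 0 1).real (Set.Iic t)) atBot (𝓝 0) := by
    simpa [← cdf_eq_real] using tendsto_cdf_atBot (gaussianReal 0 1)
  obtain ⟨t, ht, ht0⟩ := ((hcdf.eventually_lt_const (show (0 : ℝ) < 1 / 2 by norm_num)).and
    (eventually_le_atBot 0)).exists
  obtain ⟨k, hk, G, hGm, hPG, hGY⟩ :=
    (((hb t).eventually_lt_const ht).and (h (-t) (by linarith))).exists
  have h1 : (P k).real G ≤ (P k).real {ω | Y k ω ≤ t} := by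
    refine ENNReal.toReal_mono (measure_ne_top _ _) (measure_mono_ae ?_)
    filter_upwards [hGY] with ω h1 h2
    have := h1 h2
    show Y k ω ≤ t
    linarith
  linarith

end Divergence

/-! ### Divergence of the rescaled eigenvalue errors -/

section Asymptotic

variable {n p : ℕ → ℕ} {S : ∀ k, Matrix (Fin (p k)) (Fin (p k)) ℝ}

theorem exists_eventually_diag_bounds (hS : ∀ k, (S k).PosDef) (hdiag : ∀ k, (S k).IsDiag)
    (hbdd : (fun k => max ‖S k‖ ‖(S k)⁻¹‖) =O[atTop] fun _ => (1 : ℝ)) :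
    ∃ C : ℝ, 0 < C ∧ ∀ᶠ k in atTop, ∀ l, S k l l ≤ C ∧ (S k l l)⁻¹ ≤ C := by
  obtain ⟨C, hC, hb⟩ := hbdd.exists_pos
  refine ⟨C, hC, hb.bound.mono fun k hk l => ?_⟩
  rw [norm_one, mul_one, Real.norm_eq_abs] at hk
  have h := (le_abs_self _).trans hk
  have hl := diag_le_norm (hdiag k) (hS k) l
  exact ⟨hl.1.trans ((le_max_left _ _).trans h), hl.2.trans ((le_max_right _ _).trans h)⟩

theorem eventually_le_dim (hn : Tendsto n atTop atTop)
    (hlow : (fun k => Real.sqrt (n k)) =o[atTop] fun k => (p k : ℝ)) (m : ℕ) :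
    ∀ᶠ k in atTop, m ≤ p k := by
  filter_upwards [hlow.bound one_pos, hn.eventually_ge_atTop (m ^ 2)] with k hk hm
  rw [one_mul, Real.norm_of_nonneg (Real.sqrt_nonneg _), Real.norm_of_nonneg (by positivity)] at hk
  have h1 : (m : ℝ) ≤ √(n k) := Real.le_sqrt_of_sq_le (by exact_mod_cast hm)
  exact_mod_cast h1.trans hk

theorem eventually_dim_le (hn : Tendsto n atTop atTop)
    (hupp : (fun k => (p k : ℝ)) =o[atTop] fun k => (n k : ℝ) ^ (2 / 3 : ℝ)) :
    ∀ᶠ k in atTop, p k ≤ n k := by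
  filter_upwards [hupp.bound one_pos, hn.eventually_ge_atTop 1] with k hk hm
  have hm' : (1 : ℝ) ≤ n k := by exact_mod_cast hm
  rw [one_mul, Real.norm_of_nonneg (by positivity), Real.norm_of_nonneg (by positivity)] at hk
  have h1 := Real.rpow_le_rpow_of_exponent_le hm' (show (2 / 3 : ℝ) ≤ 1 by norm_num)
  rw [Real.rpow_one] at h1
  exact_mod_cast hk.trans h1

theorem exceedsLevels_eig_one_sampleCov (hn : Tendsto n atTop atTop)
    (hS : ∀ k, (S k).PosDef) (hdiag : ∀ k, (S k).IsDiag)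
    (hbdd : (fun k => max ‖S k‖ ‖(S k)⁻¹‖) =O[atTop] fun _ => (1 : ℝ))
    (hlow : (fun k => Real.sqrt (n k)) =o[atTop] fun k => (p k : ℝ)) :
    ExceedsLevels (fun k => sampleLaw (n k) (S k))
      fun k X => √(n k) * (eig (sampleCov X) 1 - eig (S k) 1) := by
  intro M hM
  obtain ⟨C, hC, hCk⟩ := exists_eventually_diag_bounds hS hdiag hbdd
  set V := Var[fun x => x ^ 2; gaussianReal 0 1] with hV
  have hV0 : 0 ≤ V := variance_nonneg _ _
  -- `δ` gives equality in `2δ√C ≤ 1/16`, and `K² ≥ 8C²V` makes the Chebyshev term at most `1/8`;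
  -- the `+ 1` makes `K` positive without showing `V > 0`.
  set δ : ℝ := 1 / (32 * √C) with hδ
  set K : ℝ := √(8 * C ^ 2 * V + 1) with hK
  have hsC : 0 < √C := Real.sqrt_pos.2 hC
  have hδ0 : 0 < δ := by positivity
  have hK0 : 0 < K := Real.sqrt_pos.2 (by positivity)
  have hδC : 2 * δ * √C ≤ 1 / 16 := by
    rw [hδ]
    field_simp
    norm_num
  have hKC : C ^ 2 * V / K ^ 2 ≤ 1 / 8 := by
    rw [hK, Real.sq_sqrt (by positivity), div_le_iff₀ (by positivity)]
    linarith
  have hsqrt : Tendsto (fun k => √(n k : ℝ)) atTop atTop :=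
    Real.tendsto_sqrt_atTop.comp (tendsto_natCast_atTop_atTop.comp hn)
  -- With this constant in `√n = o(p)`, and `p - 1 ≥ p/2`, the bias `δ²(p - 1)/(2√n)` absorbs both
  -- the level `M` and the fluctuation `K`.
  have hc : 0 < δ ^ 2 / (4 * (M + K)) := by positivity
  filter_upwards [hCk, eventually_le_dim hn hlow 2, hn.eventually_ge_atTop 1,
    hsqrt.eventually_gt_atTop (K * C), hlow.bound hc] with k hk hpk hnk hKn hlk
  obtain ⟨j, hj⟩ := exists_eig_one_eq_diag (hdiag k) (by omega)
  have hjpos : 0 < S k j j := (hS k).diag_pos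
  have hn' : (0 : ℝ) < n k := by exact_mod_cast hnk
  have hsn : 0 < √(n k : ℝ) := Real.sqrt_pos.2 hn'
  have hKn' : K / √(n k) < S k j j := by
    have h1 : 1 ≤ S k j j * C := by
      have := (hk j).2
      rwa [inv_le_iff_one_le_mul₀' hjpos] at this
    rw [div_lt_iff₀ hsn]
    nlinarith
  obtain ⟨G, hGm, hPG, hG⟩ := exists_event_le_eig_one_sampleCov (hS k) (hdiag k) hpk hnk j hδ0 hK0
    (fun l => (hk l).1) (fun l => (hk l).2) hδC hKC hKn'
  refine ⟨G, hGm, hPG, Eventually.of_forall fun X hX => ?_⟩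
  rw [hj]
  rw [Real.norm_of_nonneg hsn.le, Real.norm_of_nonneg (by positivity)] at hlk
  have hp2 : (2 : ℝ) ≤ p k := by exact_mod_cast hpk
  have hsq : √(n k : ℝ) * √(n k) = n k := Real.mul_self_sqrt hn'.le
  have hstep : M + K ≤ √(n k) * (δ ^ 2 * (p k - 1) / (2 * n k)) := by
    have h1 : √(n k) * (δ ^ 2 * (p k - 1) / (2 * n k)) = δ ^ 2 * (p k - 1) / (2 * √(n k)) := by
      nth_rewrite 2 [← hsq]
      field_simp
    rw [h1, le_div_iff₀ (by positivity)]
    have h2 : (4 * (M + K)) * √(n k) ≤ δ ^ 2 * p k := by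
      calc (4 * (M + K)) * √(n k) ≤ (4 * (M + K)) * (δ ^ 2 / (4 * (M + K)) * p k) := by gcongr
        _ = δ ^ 2 * p k := by field_simp
    have h3 : δ ^ 2 * 2 ≤ δ ^ 2 * p k := by gcongr
    nlinarith
  have hX' := hG X hX
  calc M ≤ √(n k) * (-(K / √(n k)) + δ ^ 2 * (p k - 1) / (2 * n k)) := by
        have : √(n k : ℝ) * -(K / √(n k)) = -K := by field_simp
        rw [mul_add, this]
        linarith
    _ ≤ _ := by
        refine mul_le_mul_of_nonneg_left ?_ hsn.le
        linarith

theorem eventually_ae_posDef_sampleCov (hn : Tendsto n atTop atTop) (hS : ∀ k, (S k).PosDef)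
    (hupp : (fun k => (p k : ℝ)) =o[atTop] fun k => (n k : ℝ) ^ (2 / 3 : ℝ)) :
    ∀ᶠ k in atTop, ∀ᵐ X ∂(sampleLaw (n k) (S k)), (sampleCov X).PosDef := by
  filter_upwards [eventually_dim_le hn hupp, hn.eventually_ge_atTop 1] with k hk hnk
  filter_upwards [ae_span_eq_top (hS k) hk] with X hX
  exact posDef_sampleCov X hX.ge hnk

/-- For `l = λ₁(Σ*)` and `r = √n`, `r(l⁻¹ - (l + M'/r)⁻¹) = M'/(l(l + M'/r))`. Once `M' ≤ r` the
denominator is at most `C(C + 1)`, whence the choice `M' = M·C(C + 1)`. -/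
theorem exceedsLevels_neg_eig_inv_sampleCov (hn : Tendsto n atTop atTop)
    (hS : ∀ k, (S k).PosDef) (hdiag : ∀ k, (S k).IsDiag)
    (hbdd : (fun k => max ‖S k‖ ‖(S k)⁻¹‖) =O[atTop] fun _ => (1 : ℝ))
    (hlow : (fun k => Real.sqrt (n k)) =o[atTop] fun k => (p k : ℝ))
    (hupp : (fun k => (p k : ℝ)) =o[atTop] fun k => (n k : ℝ) ^ (2 / 3 : ℝ)) :
    ExceedsLevels (fun k => sampleLaw (n k) (S k))
      fun k X => -(√(n k) * (eig (sampleCov X)⁻¹ (p k) - eig (S k)⁻¹ (p k))) := by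
  obtain ⟨C, hC, hCk⟩ := exists_eventually_diag_bounds hS hdiag hbdd
  refine (exceedsLevels_eig_one_sampleCov hn hS hdiag hbdd hlow).mono fun M hM =>
    ⟨M * (C * (C + 1)), by positivity, ?_⟩
  have hsqrt : Tendsto (fun k => √(n k : ℝ)) atTop atTop :=
    Real.tendsto_sqrt_atTop.comp (tendsto_natCast_atTop_atTop.comp hn)
  filter_upwards [hCk, eventually_le_dim hn hlow 1, hsqrt.eventually_ge_atTop (M * (C * (C + 1))),
    hsqrt.eventually_gt_atTop 0, eventually_ae_posDef_sampleCov hn hS hupp] with k hk hpk hnM hsn hPD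
  filter_upwards [hPD] with X hX hMX
  obtain ⟨j, hj⟩ := exists_eig_one_eq_diag (hdiag k) hpk
  have hl : 0 < S k j j := (hS k).diag_pos
  rw [eig_inv_last hX hpk, eig_inv_last (hS k) hpk, hj]
  rw [hj] at hMX
  set M' := M * (C * (C + 1)) with hM'
  set l := S k j j
  set r := √(n k : ℝ)
  have hM'0 : 0 ≤ M' := by positivity
  have hlow' : l + M' / r ≤ eig (sampleCov X) 1 := by
    have : M' / r ≤ eig (sampleCov X) 1 - l := by
      rw [div_le_iff₀ hsn]
      linarith
    linarith
  have hpos : 0 < l + M' / r := by positivity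
  have hinv : (eig (sampleCov X) 1)⁻¹ ≤ (l + M' / r)⁻¹ := inv_anti₀ hpos hlow'
  have h1 : M' / r ≤ 1 := (div_le_one hsn).2 hnM
  calc M = M' / (C * (C + 1)) := by rw [hM']; field_simp
    _ ≤ M' / (l * (l + M' / r)) := by
        have := (hk j).1
        gcongr
    _ = r * (l⁻¹ - (l + M' / r)⁻¹) := by
        field_simp
        ring
    _ ≤ r * (l⁻¹ - (eig (sampleCov X) 1)⁻¹) := by gcongr
    _ = _ := by ring

end Asymptotic

end EigenCounter

/-! ### The main theorem -/

theorem mainTheorem9 (n p : ℕ → ℕ) (S : ∀ k, Matrix (Fin (p k)) (Fin (p k)) ℝ)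
    (hn : Tendsto n atTop atTop)
    (hS : ∀ k, (S k).PosDef)
    (hdiag : ∀ k, (S k).IsDiag)
    (hbdd : (fun k => max ‖S k‖ ‖(S k)⁻¹‖) =O[atTop] fun _ => (1 : ℝ))
    (hgap : (fun k => EigenCounter.eig (S k) 1 - EigenCounter.eig (S k) 2)
      =Θ[atTop] fun _ => (1 : ℝ))
    (hlow : (fun k => Real.sqrt (n k)) =o[atTop] fun k => (p k : ℝ))
    (hupp : (fun k => (p k : ℝ)) =o[atTop] fun k => (n k : ℝ) ^ (2 / 3 : ℝ)) :
    -- the largest eigenvalue of the sample covariance matrix is not root-n-consistent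
    (¬ EigenCounter.RootNConsistent (fun k => EigenCounter.sampleLaw (n k) (S k)) n
        (fun _ X => EigenCounter.eig (EigenCounter.sampleCov X) 1)
        (fun k => EigenCounter.eig (S k) 1)) ∧
    -- the smallest eigenvalue of its inverse is the reciprocal of its largest eigenvalue
    (∀ᶠ k in atTop, ∀ᵐ X ∂(EigenCounter.sampleLaw (n k) (S k)),
        IsUnit (EigenCounter.sampleCov X).det ∧
        EigenCounter.eig (EigenCounter.sampleCov X)⁻¹ (p k) =
          (EigenCounter.eig (EigenCounter.sampleCov X) 1)⁻¹) ∧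
    -- and it is not root-n-consistent either
    (¬ EigenCounter.RootNConsistent (fun k => EigenCounter.sampleLaw (n k) (S k)) n
        (fun k X => EigenCounter.eig (EigenCounter.sampleCov X)⁻¹ (p k))
        (fun k => EigenCounter.eig (S k)⁻¹ (p k))) ∧
    -- in particular neither eigenvalue is asymptotically normal with the classical normalization
    (¬ EigenCounter.AsympStdNormal (fun k => EigenCounter.sampleLaw (n k) (S k))
        (fun k X => Real.sqrt (n k) *
          (EigenCounter.eig (EigenCounter.sampleCov X) 1 - EigenCounter.eig (S k) 1) /
            (Real.sqrt 2 * EigenCounter.eig (S k) 1))) ∧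
    (¬ EigenCounter.AsympStdNormal (fun k => EigenCounter.sampleLaw (n k) (S k))
        (fun k X => Real.sqrt (n k) *
          (EigenCounter.eig (EigenCounter.sampleCov X)⁻¹ (p k) -
              EigenCounter.eig (S k)⁻¹ (p k)) /
            (Real.sqrt 2 * EigenCounter.eig (S k)⁻¹ (p k)))) := by
  have hup := EigenCounter.exceedsLevels_eig_one_sampleCov hn hS hdiag hbdd hlow
  have hdown := EigenCounter.exceedsLevels_neg_eig_inv_sampleCov hn hS hdiag hbdd hlow hupp
  obtain ⟨C, hC, hCk⟩ := EigenCounter.exists_eventually_diag_bounds hS hdiag hbdd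
  have heig : ∀ᶠ k in atTop, 0 < EigenCounter.eig (S k) 1 ∧ EigenCounter.eig (S k) 1 ≤ C ∧
      EigenCounter.eig (S k)⁻¹ (p k) = (EigenCounter.eig (S k) 1)⁻¹ ∧
      (EigenCounter.eig (S k) 1)⁻¹ ≤ C := by
    filter_upwards [hCk, EigenCounter.eventually_le_dim hn hlow 1] with k hk hpk
    obtain ⟨j, hj⟩ := EigenCounter.exists_eig_one_eq_diag (hdiag k) hpk
    rw [EigenCounter.eig_inv_last (hS k) hpk, hj]
    exact ⟨(hS k).diag_pos, (hk j).1, rfl, (hk j).2⟩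
  -- The normalizers `√2·λ₁(Σ*)` and `√2·λ_p(Ω*)` are positive and at most `√2·C`, so dividing by
  -- them preserves divergence.
  have hscale : ∀ {M y a : ℝ}, 0 ≤ M → 0 < a → a ≤ C → M * (√2 * C) ≤ y → M ≤ y / (√2 * a) := by
    intro M y a hM ha haC hy
    rw [le_div_iff₀ (by positivity)]
    refine le_trans ?_ hy
    gcongr
  refine ⟨hup.not_boundedInProbability, ?_, fun hb => hdown.not_boundedInProbability ?_, ?_, ?_⟩
  · filter_upwards [EigenCounter.eventually_ae_posDef_sampleCov hn hS hupp,
      EigenCounter.eventually_le_dim hn hlow 1] with k hk hpk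
    filter_upwards [hk] with X hX
    exact ⟨hX.det_pos.ne'.isUnit, EigenCounter.eig_inv_last hX hpk⟩
  · simpa only [EigenCounter.RootNConsistent, EigenCounter.BoundedInProbability, abs_neg] using hb
  · refine EigenCounter.ExceedsLevels.not_asympStdNormal
      (hup.mono fun M hM => ⟨M * (√2 * C), by positivity, ?_⟩)
    filter_upwards [heig] with k hk
    exact Eventually.of_forall fun X hX => hscale hM hk.1 hk.2.1 hX
  · refine EigenCounter.ExceedsLevels.not_asympStdNormal_of_neg
      (hdown.mono fun M hM => ⟨M * (√2 * C), by positivity, ?_⟩)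
    filter_upwards [heig] with k hk
    refine Eventually.of_forall fun X hX => ?_
    rw [← neg_div]
    refine hscale hM ?_ ?_ hX
    · rw [hk.2.2.1]
      exact inv_pos.2 hk.1
    · rw [hk.2.2.1]
      exact hk.2.2.2
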